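/- Let $n\ge 1$ and $m\ge 0$ be integers, let $A,\bar A\in\mathbb R^{n\times n}$, $B,\bar B\in\mathbb R^{n\times m}$ and $\sigma\in\mathbb R$, and assume that the stacked matrix $\begin{bmatrix}B\\ \sigma\bar B\end{bmatrix}\in\mathbb R^{2n\times m}$ has full column rank. For a symmetric positive definite matrix $P\in\mathbb R^{n\times n}$ put $$R(P)=B^\top PB+\sigma^2\bar B^\top P\bar B,\qquad S(P)=A^\top PB+\sigma^2\bar A^\top P\bar B,$$ $$\Phi(P)=A^\top PA+\sigma^2\bar A^\top P\bar A-S(P)R(P)^{-1}S(P)^\top,$$ and, for $\tau\in(0,1)$, $$\widehat\Phi_\tau(P)=\frac{(1-\tau)\Phi(P)+\frac{\tau}{n}I}{\operatorname{Tr}\big((1-\tau)\Phi(P)+\frac{\tau}{n}I\big)}.$$ Let $C_A=\lambda_{\max}(AA^\top+\sigma^2\bar A\bar A^\top)$ and $\delta_\tau=\dfrac{\tau/n}{(1-\tau)C_A+\tau}$. Then for each $\tau\in(0,1)$ there exists a symmetric positive definite matrix $P^{(\tau)}$ with $\operatorname{Tr}P^{(\tau)}=1$ such that $$\widehat\Phi_\tau(P^{(\tau)})=P^{(\tau)}\qquad\text{and}\qquad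 P^{(\tau)}\succeq\delta_\tau I,$$ that is, $P^{(\tau)}-\delta_\tau I$ is positive semidefinite. -/

import Mathlib

open scoped Matrix

noncomputable section

namespace StabRate

variable {n m : ℕ}

/-- The stacked input matrix with upper block `B` and lower block `σ B̄`, of size `2n × m`. -/
def stackedInput (σ : ℝ) (B Bbar : Matrix (Fin n) (Fin m) ℝ) :
    Matrix (Fin n ⊕ Fin n) (Fin m) ℝ :=
  Matrix.fromRows B (σ • Bbar)

/-- The nondegeneracy assumption: the stacked input matrix has full column rank. -/
def Nondegenerate (σ : ℝ) (B Bbar : Matrix (Fin n) (Fin m) ℝ) : Prop :=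
  (stackedInput σ B Bbar).rank = m

/-- `R(P) = Bᵀ P B + σ² B̄ᵀ P B̄`. -/
def R (σ : ℝ) (B Bbar : Matrix (Fin n) (Fin m) ℝ) (P : Matrix (Fin n) (Fin n) ℝ) :
    Matrix (Fin m) (Fin m) ℝ :=
  Bᵀ * P * B + σ ^ 2 • (Bbarᵀ * P * Bbar)

/-- `S(P) = Aᵀ P B + σ² Āᵀ P B̄`. -/
def S (σ : ℝ) (A Abar : Matrix (Fin n) (Fin n) ℝ) (B Bbar : Matrix (Fin n) (Fin m) ℝ)
    (P : Matrix (Fin n) (Fin n) ℝ) : Matrix (Fin n) (Fin m) ℝ :=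
  Aᵀ * P * B + σ ^ 2 • (Abarᵀ * P * Bbar)

/-- The Riccati-type operator `Φ(P) = Aᵀ P A + σ² Āᵀ P Ā - S(P) R(P)⁻¹ S(P)ᵀ`, for `P ≻ 0`.
Under `Nondegenerate`, `R(P) ≻ 0` for such `P`, so that the inverse is a genuine one. -/
def Phi (σ : ℝ) (A Abar : Matrix (Fin n) (Fin n) ℝ) (B Bbar : Matrix (Fin n) (Fin m) ℝ)
    (P : Matrix (Fin n) (Fin n) ℝ) : Matrix (Fin n) (Fin n) ℝ :=
  Aᵀ * P * A + σ ^ 2 • (Abarᵀ * P * Abar)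
    - S σ A Abar B Bbar P * (R σ B Bbar P)⁻¹ * (S σ A Abar B Bbar P)ᵀ

/-- The regularized map `(1 - τ) Φ(P) + (τ / n) I`. -/
def regPhi (σ : ℝ) (A Abar : Matrix (Fin n) (Fin n) ℝ) (B Bbar : Matrix (Fin n) (Fin m) ℝ)
    (τ : ℝ) (P : Matrix (Fin n) (Fin n) ℝ) : Matrix (Fin n) (Fin n) ℝ :=
  (1 - τ) • Phi σ A Abar B Bbar P + (τ / (n : ℝ)) • (1 : Matrix (Fin n) (Fin n) ℝ)

/-- The regularized normalized operator `Φ̂_τ`: the regularized map divided by its trace. -/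
def PhiHat (σ : ℝ) (A Abar : Matrix (Fin n) (Fin n) ℝ) (B Bbar : Matrix (Fin n) (Fin m) ℝ)
    (τ : ℝ) (P : Matrix (Fin n) (Fin n) ℝ) : Matrix (Fin n) (Fin n) ℝ :=
  (regPhi σ A Abar B Bbar τ P).trace⁻¹ • regPhi σ A Abar B Bbar τ P

/-- The largest eigenvalue of a real symmetric matrix of size at least one. -/
def lambdaMax (M : Matrix (Fin n) (Fin n) ℝ) : ℝ :=
  sSup (spectrum ℝ M)

/-- `C_A = λ_max (A Aᵀ + σ² Ā Āᵀ)`. -/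
def CA (σ : ℝ) (A Abar : Matrix (Fin n) (Fin n) ℝ) : ℝ :=
  lambdaMax (A * Aᵀ + σ ^ 2 • (Abar * Abarᵀ))

/-- `δ_τ = (τ / n) / ((1 - τ) C_A + τ)`. -/
def delta (σ : ℝ) (A Abar : Matrix (Fin n) (Fin n) ℝ) (τ : ℝ) : ℝ :=
  (τ / (n : ℝ)) / ((1 - τ) * CA σ A Abar + τ)

end StabRate

end

/-! Completing the square (`feedbackCost_eq_Phi_add`) shows that `Phi` is the minimum over gains `K`
of `feedbackCost`, which is linear and monotone in `P`; so `Phi` is monotone (`Phi_mono`) and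
positively homogeneous. Scaling the identity term by the trace gives a homogeneous map F, `homPhi`,
whose trace-one eigenvectors are the fixed points sought.

The eigenvector comes from a Collatz–Wielandt argument: among trace-one P ⪰ δI, take the largest c
with cP ⪯ F(P). If F(P) ≠ cP, the gap has positive trace, which the trace term of F turns into a
positive multiple of I (`homPhi_sub_smul_posSemidef`). Then F(F(P)) exceeds cF(P) with room to
spare, and the normalized F(P), still ⪰ δI by `normalized_homPhi_mem`, allows a larger c. -/

open scoped Matrix

/-! ### Positive semidefinite matrices and traces. -/

namespace Matrix

variable {ι κ : Type*} [Fintype ι] [Fintype κ]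

/-- The entries of a real positive semidefinite matrix are bounded by its trace. -/
lemma PosSemidef.abs_apply_le_trace [DecidableEq ι] {M : Matrix ι ι ℝ} (hM : M.PosSemidef) (i j : ι) :
    |M i j| ≤ M.trace := by
  have hdiag : ∀ k, 0 ≤ M k k := fun k => hM.diag_nonneg
  have hle : ∀ k, M k k ≤ M.trace := fun k =>
    Finset.single_le_sum (f := fun k => M k k) (fun k _ => hdiag k) (Finset.mem_univ k)
  have hsymm : M j i = M i j := by simpa using hM.1.apply i j
  -- Testing on e_i ± e_j gives 2|M_ij| ≤ M_ii + M_jj.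
  have h1 := hM.dotProduct_mulVec_nonneg (Pi.single i 1 + Pi.single j 1)
  have h2 := hM.dotProduct_mulVec_nonneg (Pi.single i 1 - Pi.single j 1)
  simp [mulVec_add, mulVec_sub, add_dotProduct, sub_dotProduct, hsymm] at h1 h2
  have hi := hle i
  have hj := hle j
  rw [abs_le]
  constructor <;> linarith

lemma PosSemidef.eq_zero_of_trace_eq_zero [DecidableEq ι] {M : Matrix ι ι ℝ} (hM : M.PosSemidef)
    (h : M.trace = 0) : M = 0 := by
  ext i j
  have := hM.abs_apply_le_trace i j
  rw [h] at this
  simpa using abs_nonpos_iff.1 this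

open scoped MatrixOrder Matrix.Norms.L2Operator in
lemma PosSemidef.trace_mul_nonneg [DecidableEq ι] {M N : Matrix ι ι ℝ} (hM : M.PosSemidef)
    (hN : N.PosSemidef) : 0 ≤ (M * N).trace := by
  obtain ⟨X, rfl⟩ := CStarAlgebra.nonneg_iff_eq_star_mul_self.1 hN.nonneg
  rw [star_eq_conjTranspose]
  rw [← Matrix.mul_assoc, trace_mul_comm, ← Matrix.mul_assoc]
  exact (hM.mul_mul_conjTranspose_same X).trace_nonneg

lemma isClosed_setOf_posSemidef : IsClosed {M : Matrix ι ι ℝ | M.PosSemidef} := by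
  simp only [posSemidef_iff_dotProduct_mulVec, Set.ofPred_and, Set.ofPred_forall]
  refine IsClosed.inter ?_ (isClosed_iInter fun x => ?_)
  · exact isClosed_eq (continuous_id.matrix_conjTranspose) continuous_id
  · exact isClosed_le continuous_const
      (Continuous.dotProduct continuous_const (continuous_id.matrix_mulVec continuous_const))

lemma PosSemidef.transpose_mul_mul_same {M : Matrix ι ι ℝ} (hM : M.PosSemidef)
    (X : Matrix ι κ ℝ) : (Xᵀ * M * X).PosSemidef := by
  simpa using hM.conjTranspose_mul_mul_same X

omit [Fintype ι] in
lemma mulVec_injective_of_rank_eq_card {X : Matrix ι κ ℝ} (h : X.rank = Fintype.card κ) :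
    Function.Injective X.mulVec := by
  have h0 := X.mulVecLin.finrank_range_add_finrank_ker
  rw [← Matrix.rank, h, Module.finrank_fintype_fun_eq_card] at h0
  have h1 : X.mulVecLin.ker = ⊥ := Submodule.finrank_eq_zero.1 (by omega)
  exact LinearMap.ker_eq_bot.1 h1

end Matrix

namespace StabRate

open Matrix

variable {n m : ℕ} {σ τ : ℝ} {A Abar : Matrix (Fin n) (Fin n) ℝ} {B Bbar : Matrix (Fin n) (Fin m) ℝ}
  {P Q : Matrix (Fin n) (Fin n) ℝ}

lemma posSemidef_lambdaMax_smul_one_sub {M : Matrix (Fin n) (Fin n) ℝ} (hM : M.IsHermitian) :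
    (lambdaMax M • (1 : Matrix (Fin n) (Fin n) ℝ) - M).PosSemidef := by
  rw [posSemidef_iff_isHermitian_and_spectrum_nonneg]
  refine ⟨(isHermitian_one.smul (by simp [IsSelfAdjoint])).sub hM, ?_⟩
  rw [← Algebra.algebraMap_eq_smul_one, ← spectrum.singleton_sub_eq]
  rintro _ ⟨_, rfl, x, hx, rfl⟩
  have hb : BddAbove (spectrum ℝ M) := by
    rw [hM.spectrum_real_eq_range_eigenvalues]
    exact (Set.finite_range _).bddAbove
  exact sub_nonneg.2 (le_csSup hb hx)

lemma lambdaMax_nonneg {M : Matrix (Fin n) (Fin n) ℝ} (hM : M.PosSemidef) : 0 ≤ lambdaMax M :=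
  Real.sSup_nonneg fun _ hx => (posSemidef_iff_isHermitian_and_spectrum_nonneg.1 hM).2 hx

lemma posSemidef_gram (σ : ℝ) (A Abar : Matrix (Fin n) (Fin n) ℝ) :
    (A * Aᵀ + σ ^ 2 • (Abar * Abarᵀ)).PosSemidef := by
  simpa using (posSemidef_self_mul_conjTranspose A).add
    ((posSemidef_self_mul_conjTranspose Abar).smul (sq_nonneg σ))

lemma CA_nonneg (σ : ℝ) (A Abar : Matrix (Fin n) (Fin n) ℝ) : 0 ≤ CA σ A Abar :=
  lambdaMax_nonneg (posSemidef_gram σ A Abar)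

/-! ### `Phi` as a minimum over feedback gains. -/

/-- `(A + B K)ᵀ P (A + B K) + σ² (Ā + B̄ K)ᵀ P (Ā + B̄ K)`, the cost of the feedback gain `K`. -/
def feedbackCost (σ : ℝ) (A Abar : Matrix (Fin n) (Fin n) ℝ) (B Bbar : Matrix (Fin n) (Fin m) ℝ)
    (K : Matrix (Fin m) (Fin n) ℝ) (P : Matrix (Fin n) (Fin n) ℝ) : Matrix (Fin n) (Fin n) ℝ :=
  (A + B * K)ᵀ * P * (A + B * K) + σ ^ 2 • ((Abar + Bbar * K)ᵀ * P * (Abar + Bbar * K))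

lemma feedbackCost_posSemidef (K : Matrix (Fin m) (Fin n) ℝ) (hP : P.PosSemidef) :
    (feedbackCost σ A Abar B Bbar K P).PosSemidef :=
  (hP.transpose_mul_mul_same _).add ((hP.transpose_mul_mul_same _).smul (sq_nonneg σ))

lemma feedbackCost_sub (K : Matrix (Fin m) (Fin n) ℝ) :
    feedbackCost σ A Abar B Bbar K (Q - P)
      = feedbackCost σ A Abar B Bbar K Q - feedbackCost σ A Abar B Bbar K P := by
  simp only [feedbackCost, Matrix.mul_sub, Matrix.sub_mul, smul_sub]
  abel

/-- The quadratic form at x is that of P at Bx plus that of P at σB̄x; full column rank keeps these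
two vectors from vanishing together. -/
lemma R_posDef (hU : Nondegenerate σ B Bbar) (hP : P.PosDef) : (R σ B Bbar P).PosDef := by
  have hps : (R σ B Bbar P).PosSemidef :=
    (hP.posSemidef.transpose_mul_mul_same _).add
      ((hP.posSemidef.transpose_mul_mul_same _).smul (sq_nonneg σ))
  refine PosDef.of_dotProduct_mulVec_pos hps.1 fun x hx => ?_
  have key : star x ⬝ᵥ (R σ B Bbar P *ᵥ x)
      = star (B *ᵥ x) ⬝ᵥ (P *ᵥ (B *ᵥ x))
        + star ((σ • Bbar) *ᵥ x) ⬝ᵥ (P *ᵥ ((σ • Bbar) *ᵥ x)) := by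
    simp only [R, star_trivial, add_mulVec, dotProduct_add, smul_mulVec, mulVec_smul,
      smul_dotProduct, dotProduct_smul, ← mulVec_mulVec, dotProduct_mulVec x, vecMul_transpose,
      sq, smul_eq_mul]
    ring
  rw [key]
  have h1 := hP.posSemidef.dotProduct_mulVec_nonneg (B *ᵥ x)
  have h2 := hP.posSemidef.dotProduct_mulVec_nonneg ((σ • Bbar) *ᵥ x)
  by_cases hB : B *ᵥ x = 0
  · have hB' : (σ • Bbar) *ᵥ x ≠ 0 := fun h => hx <| by
      refine mulVec_injective_of_rank_eq_card (X := stackedInput σ B Bbar)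
        (hU.trans (Fintype.card_fin m).symm) ?_
      simp only [stackedInput, fromRows_mulVec, hB, h, mulVec_zero]
      ext i; cases i <;> rfl
    exact add_pos_of_nonneg_of_pos h1 (hP.dotProduct_mulVec_pos hB')
  · exact add_pos_of_pos_of_nonneg (hP.dotProduct_mulVec_pos hB) h2

lemma feedbackCost_eq (K : Matrix (Fin m) (Fin n) ℝ) (hP : P.IsHermitian) :
    feedbackCost σ A Abar B Bbar K P
      = Aᵀ * P * A + σ ^ 2 • (Abarᵀ * P * Abar) + S σ A Abar B Bbar P * K
        + Kᵀ * (S σ A Abar B Bbar P)ᵀ + Kᵀ * R σ B Bbar P * K := by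
  have hPt : Pᵀ = P := by simpa using hP.eq
  simp only [feedbackCost, S, R, transpose_add, transpose_mul, transpose_smul, transpose_transpose,
    hPt, Matrix.add_mul, Matrix.mul_add, Matrix.smul_mul, Matrix.mul_smul, smul_add,
    Matrix.mul_assoc]
  abel

/-- Completion of the square. -/
lemma feedbackCost_eq_Phi_add (hU : Nondegenerate σ B Bbar) (K : Matrix (Fin m) (Fin n) ℝ)
    (hP : P.PosDef) :
    feedbackCost σ A Abar B Bbar K P = Phi σ A Abar B Bbar P
      + (K + (R σ B Bbar P)⁻¹ * (S σ A Abar B Bbar P)ᵀ)ᵀ * R σ B Bbar P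
        * (K + (R σ B Bbar P)⁻¹ * (S σ A Abar B Bbar P)ᵀ) := by
  have hR := R_posDef hU hP
  have hRt : ((R σ B Bbar P)⁻¹)ᵀ = (R σ B Bbar P)⁻¹ := by simpa using hR.inv.isHermitian.eq
  have hdet : IsUnit (R σ B Bbar P).det := hR.det_pos.ne'.isUnit
  rw [feedbackCost_eq K hP.isHermitian, Phi]
  simp only [transpose_add, transpose_mul, transpose_transpose, hRt, Matrix.add_mul,
    Matrix.mul_add, Matrix.mul_assoc, mul_nonsing_inv_cancel_left _ _ hdet,
    nonsing_inv_mul_cancel_left _ _ hdet]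
  abel

lemma feedbackCost_sub_Phi_posSemidef (hU : Nondegenerate σ B Bbar)
    (K : Matrix (Fin m) (Fin n) ℝ) (hP : P.PosDef) :
    (feedbackCost σ A Abar B Bbar K P - Phi σ A Abar B Bbar P).PosSemidef := by
  rw [feedbackCost_eq_Phi_add hU K hP, add_sub_cancel_left]
  exact (R_posDef hU hP).posSemidef.transpose_mul_mul_same _

lemma exists_feedbackCost_eq_Phi (hU : Nondegenerate σ B Bbar) (hP : P.PosDef) :
    ∃ K : Matrix (Fin m) (Fin n) ℝ,
      feedbackCost σ A Abar B Bbar K P = Phi σ A Abar B Bbar P :=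
  ⟨-((R σ B Bbar P)⁻¹ * (S σ A Abar B Bbar P)ᵀ), by
    rw [feedbackCost_eq_Phi_add hU _ hP, neg_add_cancel, Matrix.mul_zero, add_zero]⟩

lemma Phi_posSemidef (hU : Nondegenerate σ B Bbar) (hP : P.PosDef) :
    (Phi σ A Abar B Bbar P).PosSemidef := by
  obtain ⟨K, hK⟩ := exists_feedbackCost_eq_Phi (A := A) (Abar := Abar) hU hP
  exact hK ▸ feedbackCost_posSemidef K hP.posSemidef

/-- With K optimal for Q, Φ(Q) - Φ(P) is the K-cost of Q - P plus the excess of the K-cost of P over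
Φ(P). -/
lemma Phi_mono (hU : Nondegenerate σ B Bbar) (hP : P.PosDef) (hQ : Q.PosDef)
    (hPQ : (Q - P).PosSemidef) :
    (Phi σ A Abar B Bbar Q - Phi σ A Abar B Bbar P).PosSemidef := by
  obtain ⟨K, hK⟩ := exists_feedbackCost_eq_Phi (A := A) (Abar := Abar) hU hQ
  have h := (feedbackCost_posSemidef (σ := σ) (A := A) (Abar := Abar) (B := B) (Bbar := Bbar)
    K hPQ).add (feedbackCost_sub_Phi_posSemidef (A := A) (Abar := Abar) hU K hP)
  rwa [feedbackCost_sub, hK, sub_add_sub_cancel] at h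

lemma Phi_smul {c : ℝ} (hc : c ≠ 0) (hU : Nondegenerate σ B Bbar) (hP : P.PosDef) :
    Phi σ A Abar B Bbar (c • P) = c • Phi σ A Abar B Bbar P := by
  have hR : R σ B Bbar (c • P) = c • R σ B Bbar P := by
    simp only [R, Matrix.mul_smul, Matrix.smul_mul, smul_add, smul_comm c]
  have hS : S σ A Abar B Bbar (c • P) = c • S σ A Abar B Bbar P := by
    simp only [S, Matrix.mul_smul, Matrix.smul_mul, smul_add, smul_comm c]
  have hinv : (c • R σ B Bbar P)⁻¹ = c⁻¹ • (R σ B Bbar P)⁻¹ := by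
    simpa [Units.smul_def] using
      Matrix.inv_smul' (A := R σ B Bbar P) (Units.mk0 c hc) (R_posDef hU hP).det_pos.ne'.isUnit
  simp only [Phi, hR, hS, hinv, transpose_smul, Matrix.mul_smul, Matrix.smul_mul, smul_sub,
    smul_add, smul_comm c (σ ^ 2), smul_smul]
  simp [hc]

/-- The zero gain bounds Φ(P) above, and cyclicity of the trace brings out the matrix defining `CA`.
-/
lemma trace_Phi_le (hU : Nondegenerate σ B Bbar) (hP : P.PosDef) :
    (Phi σ A Abar B Bbar P).trace ≤ CA σ A Abar * P.trace := by
  have h1 := (feedbackCost_sub_Phi_posSemidef (A := A) (Abar := Abar) hU 0 hP).trace_nonneg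
  have h2 := hP.posSemidef.trace_mul_nonneg
    (posSemidef_lambdaMax_smul_one_sub (posSemidef_gram σ A Abar).1)
  have h3 : (feedbackCost σ A Abar B Bbar 0 P).trace
      = (P * (A * Aᵀ + σ ^ 2 • (Abar * Abarᵀ))).trace := by
    simp only [feedbackCost, Matrix.mul_zero, add_zero, Matrix.mul_add, Matrix.mul_smul,
      trace_add, trace_smul]
    rw [Matrix.mul_assoc, trace_mul_comm, Matrix.mul_assoc Abarᵀ, trace_mul_comm Abarᵀ,
      Matrix.mul_assoc, Matrix.mul_assoc]
  rw [trace_sub, h3] at h1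
  simp only [Matrix.mul_sub, trace_sub, Matrix.mul_smul, trace_smul, Matrix.mul_one,
    smul_eq_mul] at h2
  rw [CA]
  linarith

lemma continuousOn_Phi (hU : Nondegenerate σ B Bbar) :
    ContinuousOn (Phi σ A Abar B Bbar) {P | P.PosDef} := by
  have hR : Continuous (R σ B Bbar) := by unfold R; fun_prop
  have hS : Continuous (S σ A Abar B Bbar) := by unfold S; fun_prop
  have hinv : ContinuousOn (fun P => (R σ B Bbar P)⁻¹) {P | P.PosDef} := by
    simp only [inv_def, Ring.inverse_eq_inv']
    exact (hR.matrix_det.continuousOn.inv₀ fun P hP => (R_posDef hU hP).det_pos.ne').smul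
      hR.matrix_adjugate.continuousOn
  have hST : Continuous (fun P => (S σ A Abar B Bbar P)ᵀ) := hS.matrix_transpose
  have h0 : Continuous fun P : Matrix (Fin n) (Fin n) ℝ =>
      Aᵀ * P * A + σ ^ 2 • (Abarᵀ * P * Abar) := by fun_prop
  rw [continuousOn_iff_continuous_domRestrict] at *
  exact (h0.comp continuous_subtype_val).sub
    (((hS.comp continuous_subtype_val).matrix_mul hinv).matrix_mul
      (hST.comp continuous_subtype_val))

/-! ### The homogeneous regularized map. -/

/-- The positively homogeneous map that agrees with `regPhi` on matrices of trace one. -/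
noncomputable def homPhi (σ : ℝ) (A Abar : Matrix (Fin n) (Fin n) ℝ) (B Bbar : Matrix (Fin n) (Fin m) ℝ)
    (τ : ℝ) (P : Matrix (Fin n) (Fin n) ℝ) : Matrix (Fin n) (Fin n) ℝ :=
  (1 - τ) • Phi σ A Abar B Bbar P + (τ / (n : ℝ) * P.trace) • (1 : Matrix (Fin n) (Fin n) ℝ)

lemma homPhi_smul {c : ℝ} (hc : c ≠ 0) (hU : Nondegenerate σ B Bbar) (hP : P.PosDef) :
    homPhi σ A Abar B Bbar τ (c • P) = c • homPhi σ A Abar B Bbar τ P := by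
  simp only [homPhi, Phi_smul hc hU hP, trace_smul, smul_eq_mul]
  module

lemma homPhi_sub_posSemidef (hτ : τ ∈ Set.Ioo (0 : ℝ) 1) (hU : Nondegenerate σ B Bbar)
    (hP : P.PosDef) :
    (homPhi σ A Abar B Bbar τ P - (τ / n * P.trace) • (1 : Matrix (Fin n) (Fin n) ℝ)).PosSemidef := by
  rw [homPhi, add_sub_cancel_right]
  exact (Phi_posSemidef hU hP).smul (sub_nonneg.2 hτ.2.le)

lemma homPhi_posDef (hn : 1 ≤ n) (hτ : τ ∈ Set.Ioo (0 : ℝ) 1) (hU : Nondegenerate σ B Bbar)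
    (hP : P.PosDef) : (homPhi σ A Abar B Bbar τ P).PosDef := by
  have : Nonempty (Fin n) := ⟨⟨0, hn⟩⟩
  have hn' : (0 : ℝ) < n := by exact_mod_cast hn
  have : 0 < τ / n * P.trace := mul_pos (div_pos hτ.1 hn') hP.trace_pos
  exact PosDef.posSemidef_add ((Phi_posSemidef hU hP).smul (sub_nonneg.2 hτ.2.le))
    (PosDef.one.smul this)

lemma trace_homPhi_le (hn : 1 ≤ n) (hτ : τ ∈ Set.Ioo (0 : ℝ) 1) (hU : Nondegenerate σ B Bbar)
    (hP : P.PosDef) :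
    (homPhi σ A Abar B Bbar τ P).trace ≤ ((1 - τ) * CA σ A Abar + τ) * P.trace := by
  have hn' : (n : ℝ) ≠ 0 := by positivity
  have h := mul_le_mul_of_nonneg_left (trace_Phi_le (A := A) (Abar := Abar) hU hP)
    (sub_nonneg.2 hτ.2.le)
  have h2 : τ / n * P.trace * n = τ * P.trace := by field_simp
  simp only [homPhi, trace_add, trace_smul, smul_eq_mul, trace_one, Fintype.card_fin, h2]
  linarith

/-- Superadditivity in the direction of the trace: the gain that makes the eigenvalue improve. -/
lemma homPhi_sub_smul_posSemidef (hτ : τ ∈ Set.Ioo (0 : ℝ) 1) (hU : Nondegenerate σ B Bbar)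
    (hP : P.PosDef) (hQ : Q.PosDef) {c : ℝ} (hc : 0 ≤ c) (h : (Q - c • P).PosSemidef) :
    (homPhi σ A Abar B Bbar τ Q - c • homPhi σ A Abar B Bbar τ P
      - (τ / n * (Q - c • P).trace) • (1 : Matrix (Fin n) (Fin n) ℝ)).PosSemidef := by
  have key : (Phi σ A Abar B Bbar Q - c • Phi σ A Abar B Bbar P).PosSemidef := by
    -- For c = 0 the matrix cP is not positive definite in general, so homogeneity and monotonicity
    -- do not apply.
    rcases hc.eq_or_lt with rfl | hc
    · simpa using Phi_posSemidef hU hQ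
    · rw [← Phi_smul hc.ne' hU hP]
      exact Phi_mono hU (hP.smul hc) hQ h
  convert key.smul (sub_nonneg.2 hτ.2.le) using 1
  simp only [homPhi, trace_sub, trace_smul, smul_eq_mul]
  module

/-! ### The compact invariant domain and the eigenvector. -/

/-- The matrices of trace one that dominate `d I`. -/
def traceOneAbove (n : ℕ) (d : ℝ) : Set (Matrix (Fin n) (Fin n) ℝ) :=
  {P | P.trace = 1 ∧ (P - d • (1 : Matrix (Fin n) (Fin n) ℝ)).PosSemidef}

lemma posDef_of_mem_traceOneAbove {d : ℝ} (hd : 0 < d) (hP : P ∈ traceOneAbove n d) :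
    P.PosDef := by
  simpa using PosDef.posSemidef_add hP.2 (PosDef.one.smul hd)

lemma isCompact_traceOneAbove {d : ℝ} (hd : 0 < d) : IsCompact (traceOneAbove n d) := by
  have hbox : IsCompact (Set.univ.pi fun _ : Fin n => Set.univ.pi fun _ : Fin n =>
      Set.Icc (-1 : ℝ) 1) :=
    isCompact_univ_pi fun _ => isCompact_univ_pi fun _ => isCompact_Icc
  refine IsCompact.of_isClosed_subset hbox ?_ fun P hP i _ j _ => ?_
  · refine (isClosed_eq continuous_id.matrix_trace continuous_const).inter
      (isClosed_setOf_posSemidef.preimage ?_)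
    fun_prop
  · have := (posDef_of_mem_traceOneAbove hd hP).posSemidef.abs_apply_le_trace i j
    rw [hP.1] at this
    exact abs_le.1 this

lemma continuousOn_homPhi (hU : Nondegenerate σ B Bbar) :
    ContinuousOn (homPhi σ A Abar B Bbar τ) {P | P.PosDef} := by
  have h : Continuous fun P : Matrix (Fin n) (Fin n) ℝ =>
      (τ / (n : ℝ) * P.trace) • (1 : Matrix (Fin n) (Fin n) ℝ) := by fun_prop
  exact ((continuousOn_Phi hU).const_smul (1 - τ)).add h.continuousOn

lemma delta_pos (hn : 1 ≤ n) (hτ : τ ∈ Set.Ioo (0 : ℝ) 1) : 0 < delta σ A Abar τ := by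
  have hn' : (0 : ℝ) < n := by exact_mod_cast hn
  have := mul_nonneg (sub_nonneg.2 hτ.2.le) (CA_nonneg σ A Abar)
  exact div_pos (div_pos hτ.1 hn') (by linarith [hτ.1])

lemma mul_delta (hτ : τ ∈ Set.Ioo (0 : ℝ) 1) :
    ((1 - τ) * CA σ A Abar + τ) * delta σ A Abar τ = τ / n := by
  have := mul_nonneg (sub_nonneg.2 hτ.2.le) (CA_nonneg σ A Abar)
  exact mul_div_cancel₀ _ (by linarith [hτ.1] : (0 : ℝ) < (1 - τ) * CA σ A Abar + τ).ne'

/-- This is where δ comes from: F(P) ⪰ (τ/n)I, while its trace is at most (1 - τ)C_A + τ. -/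
lemma normalized_homPhi_mem (hn : 1 ≤ n) (hτ : τ ∈ Set.Ioo (0 : ℝ) 1)
    (hU : Nondegenerate σ B Bbar) (hP : P ∈ traceOneAbove n (delta σ A Abar τ)) :
    (homPhi σ A Abar B Bbar τ P).trace⁻¹ • homPhi σ A Abar B Bbar τ P
      ∈ traceOneAbove n (delta σ A Abar τ) := by
  have : Nonempty (Fin n) := ⟨⟨0, hn⟩⟩
  have hP' := posDef_of_mem_traceOneAbove (delta_pos hn hτ) hP
  have ht : 0 < (homPhi σ A Abar B Bbar τ P).trace := (homPhi_posDef hn hτ hU hP').trace_pos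
  have hle := trace_homPhi_le (A := A) (Abar := Abar) hn hτ hU hP'
  have hlow := homPhi_sub_posSemidef (A := A) (Abar := Abar) hτ hU hP'
  rw [hP.1, mul_one] at hle hlow
  refine ⟨by simp [ht.ne'], ?_⟩
  set F := homPhi σ A Abar B Bbar τ P with hF
  have hd := mul_le_mul_of_nonneg_right hle (delta_pos (σ := σ) (A := A) (Abar := Abar) hn hτ).le
  rw [mul_delta hτ] at hd
  have h := (hlow.add ((PosSemidef.one (n := Fin n) (R := ℝ)).smul (sub_nonneg.2 hd))).smul
    (inv_nonneg.2 ht.le)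
  convert h using 1
  have : delta σ A Abar τ = F.trace⁻¹ * (F.trace * delta σ A Abar τ) := by
    field_simp
  nth_rewrite 1 [this]
  module

/-- A nonlinear Perron–Frobenius theorem for `homPhi`. -/
theorem exists_homPhi_eq_smul (hn : 1 ≤ n) (hτ : τ ∈ Set.Ioo (0 : ℝ) 1)
    (hU : Nondegenerate σ B Bbar) :
    ∃ P ∈ traceOneAbove n (delta σ A Abar τ), ∃ c : ℝ,
      homPhi σ A Abar B Bbar τ P = c • P := by
  have : Nonempty (Fin n) := ⟨⟨0, hn⟩⟩
  have hn' : (0 : ℝ) < n := by exact_mod_cast hn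
  have hδ : 0 < delta σ A Abar τ := delta_pos hn hτ
  have hpd : ∀ P ∈ traceOneAbove n (delta σ A Abar τ), P.PosDef := fun P hP =>
    posDef_of_mem_traceOneAbove hδ hP
  set F := homPhi σ A Abar B Bbar τ with hF
  set D := traceOneAbove n (delta σ A Abar τ) with hD
  set b := (1 - τ) * CA σ A Abar + τ with hb
  -- Pairs (c, P) with cP ⪯ F(P). The cap b, which bounds the trace of F on D, makes the set
  -- compact.
  set T : Set (ℝ × Matrix (Fin n) (Fin n) ℝ) :=
    (Set.Icc 0 b ×ˢ D) ∩ (fun x => F x.2 - x.1 • x.2) ⁻¹' {M | M.PosSemidef} with hT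
  have hcont : ContinuousOn (fun x : ℝ × Matrix (Fin n) (Fin n) ℝ => F x.2 - x.1 • x.2)
      (Set.Icc 0 b ×ˢ D) :=
    ((continuousOn_homPhi hU).comp continuousOn_snd fun x hx => hpd _ hx.2).sub
      (continuousOn_fst.smul continuousOn_snd)
  have hcompact : IsCompact (Set.Icc 0 b ×ˢ D) := isCompact_Icc.prod (isCompact_traceOneAbove hδ)
  have hTc : IsCompact T :=
    hcompact.of_isClosed_subset
      (hcont.preimage_isClosed_of_isClosed hcompact.isClosed isClosed_setOf_posSemidef)
      Set.inter_subset_left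
  have hbpos : τ ≤ b := by
    have := mul_nonneg (sub_nonneg.2 hτ.2.le) (CA_nonneg σ A Abar)
    linarith
  have hP₀ : (1 / n : ℝ) • (1 : Matrix (Fin n) (Fin n) ℝ) ∈ D := by
    refine ⟨by simp [hn'.ne'], ?_⟩
    rw [← sub_smul]
    refine PosSemidef.one.smul (sub_nonneg.2 ?_)
    have h := mul_le_mul_of_nonneg_right hbpos hδ.le
    rw [mul_delta hτ] at h
    have : τ * delta σ A Abar τ ≤ τ * (1 / n) := by rw [mul_one_div]; exact h
    exact le_of_mul_le_mul_left this hτ.1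
  have hTne : T.Nonempty :=
    ⟨(0, (1 / n : ℝ) • 1), ⟨⟨le_rfl, hτ.1.le.trans hbpos⟩, hP₀⟩, by
      simpa using (homPhi_posDef hn hτ hU (hpd _ hP₀)).posSemidef⟩
  obtain ⟨⟨c, P⟩, ⟨⟨⟨hc0, -⟩, hPD⟩, hps⟩, hmax⟩ := hTc.exists_isMaxOn hTne continuousOn_fst
  simp only at hc0 hPD
  replace hps : (F P - c • P).PosSemidef := hps
  refine ⟨P, hPD, c, ?_⟩
  by_contra hne
  have hgap : 0 < (F P - c • P).trace :=
    hps.trace_nonneg.lt_of_ne' fun h => hne (sub_eq_zero.1 (hps.eq_zero_of_trace_eq_zero h))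
  have hQ : (F P).PosDef := homPhi_posDef hn hτ hU (hpd P hPD)
  have ht : 0 < (F P).trace := hQ.trace_pos
  have himp := homPhi_sub_smul_posSemidef (A := A) (Abar := Abar) hτ hU (hpd P hPD) hQ hc0 hps
  rw [← hF] at himp
  set g := τ / n * (F P - c • P).trace with hg
  have hgpos : 0 < g := mul_pos (div_pos hτ.1 hn') hgap
  have hL := lambdaMax_nonneg hQ.posSemidef
  set L := lambdaMax (F P)
  -- Since F(P) ⪯ (L + 1)I, the gain gI dominates g/(L + 1) times F(P); the added 1 keeps the
  -- denominator positive.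
  have hη : 0 < g / (L + 1) := div_pos hgpos (by linarith)
  have hstep : (F (F P) - (c + g / (L + 1)) • F P).PosSemidef := by
    have h1 := (posSemidef_lambdaMax_smul_one_sub hQ.isHermitian).smul hη.le
    have h2 := (himp.add h1).add ((PosSemidef.one (n := Fin n) (R := ℝ)).smul hη.le)
    convert h2 using 1
    have : g = g / (L + 1) * L + g / (L + 1) := by field_simp
    nth_rewrite 2 [this]
    module
  have hQD : (F P).trace⁻¹ • F P ∈ D := normalized_homPhi_mem hn hτ hU hPD
  have hps' : (F ((F P).trace⁻¹ • F P) - (c + g / (L + 1)) • ((F P).trace⁻¹ • F P)).PosSemidef := by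
    rw [hF, homPhi_smul (inv_ne_zero ht.ne') hU hQ, ← hF, smul_comm, ← smul_sub]
    exact hstep.smul (inv_nonneg.2 ht.le)
  -- The cap is never an obstruction: taking traces in `hps'` bounds the new constant by b.
  have hle : c + g / (L + 1) ≤ b := by
    have h1 := hps'.trace_nonneg
    have h2 := trace_homPhi_le (A := A) (Abar := Abar) hn hτ hU (hpd _ hQD)
    rw [trace_sub, trace_smul, hQD.1] at h1
    rw [hQD.1, mul_one, ← hF] at h2
    simp only [smul_eq_mul, mul_one] at h1
    linarith
  have := hmax (show (c + g / (L + 1), (F P).trace⁻¹ • F P) ∈ T from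
    ⟨⟨⟨by linarith, hle⟩, hQD⟩, hps'⟩)
  simp only [Set.mem_ofPred_eq] at this
  linarith

end StabRate

theorem mainTheorem2 (n m : ℕ) (hn : 1 ≤ n) (σ : ℝ)
    (A Abar : Matrix (Fin n) (Fin n) ℝ) (B Bbar : Matrix (Fin n) (Fin m) ℝ)
    (hU : StabRate.Nondegenerate σ B Bbar) (τ : ℝ) (hτ : τ ∈ Set.Ioo (0 : ℝ) 1) :
    ∃ P : Matrix (Fin n) (Fin n) ℝ,
      P.PosDef ∧ P.trace = 1 ∧
      StabRate.PhiHat σ A Abar B Bbar τ P = P ∧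
      (P - StabRate.delta σ A Abar τ • (1 : Matrix (Fin n) (Fin n) ℝ)).PosSemidef := by
  have : Nonempty (Fin n) := ⟨⟨0, hn⟩⟩
  obtain ⟨P, hP, c, hc⟩ :=
    StabRate.exists_homPhi_eq_smul (A := A) (Abar := Abar) hn hτ hU
  have hpd := StabRate.posDef_of_mem_traceOneAbove (StabRate.delta_pos hn hτ) hP
  have hF : StabRate.regPhi σ A Abar B Bbar τ P = c • P := by
    rw [← hc, StabRate.regPhi, StabRate.homPhi, hP.1, mul_one]
  -- As P has trace one, this trace is c, which is also the normalizing factor in `PhiHat`.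
  have htr : 0 < (c • P).trace := hc ▸ (StabRate.homPhi_posDef hn hτ hU hpd).trace_pos
  refine ⟨P, hpd, hP.1, ?_, hP.2⟩
  rw [Matrix.trace_smul, hP.1, smul_eq_mul, mul_one] at htr
  rw [StabRate.PhiHat, hF, Matrix.trace_smul, hP.1, smul_eq_mul, mul_one, smul_smul,
    inv_mul_cancel₀ htr.ne', one_smul]
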